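/- Let $G=(S,T,E)$ be a finite bipartite graph with vertex set $V=S\cup T$ (with $S\cap T=\emptyset$ and every edge joining $S$ to $T$). For a matching $M$ of $G$ let $V(M)$ be the set of vertices covered by $M$, and let $B(M)=V(M)\,\Delta\, S$, where $\Delta$ denotes symmetric difference. Let $M$ be chosen uniformly at random among all matchings of $G$ with the maximum number of edges. Then the random subset $B(M)$ of $V$ satisfies the BK inequality for increasing events: for all families $\mathcal{A},\mathcal{B}\subseteq 2^V$ that are upward closed under inclusion, \[\mathbb{P}\bigl(B(M)\in \mathcal{A}\,\square\, \mathcal{B}\bigr)\le \mathbb{P}\bigl(B(M)\in\mathcal{A}\bigr)\,\mathbb{P}\bigl(B(M)\in\mathcal{B}\bigr),\] where $\mathcal{A}\,\square\,\mathcal{B}=\{A\cup B : A\in\mathcal{A},\ B\in\mathcal{B},\ A\cap B=\emptyset\}$. -/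

import Mathlib

namespace BKMatching

open SimpleGraph
open scoped symmDiff

/-- The maximum size matchings of `G`: matchings (identified with subgraphs in which each vertex
has exactly one neighbour) such that no matching of `G` has more edges. -/
def maximumMatchings {V : Type*} (G : SimpleGraph V) : Set G.Subgraph :=
  {M | M.IsMatching ∧ ∀ N : G.Subgraph, N.IsMatching → N.edgeSet.ncard ≤ M.edgeSet.ncard}

theorem maximumMatchings_nonempty {V : Type*} [Finite V] (G : SimpleGraph V) :
    (maximumMatchings G).Nonempty := by
  obtain ⟨M, hM, hmax⟩ := Set.exists_max_image {M : G.Subgraph | M.IsMatching}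
    (fun M => M.edgeSet.ncard) (Set.toFinite _) ⟨⊥, fun v hv => absurd hv (by simp)⟩
  exact ⟨M, hM, fun N hN => hmax N hN⟩

/-- The uniform distribution on the maximum size matchings of `G`. -/
noncomputable def uniformMaximumMatching {V : Type*} [Finite V] (G : SimpleGraph V) :
    PMF G.Subgraph :=
  PMF.uniformOfFinset (Set.toFinite (maximumMatchings G)).toFinset
    ((Set.Finite.toFinset_nonempty _).mpr (maximumMatchings_nonempty G))

/-- `B(M) = V(M) ∆ S`, where `V(M)` is the set of vertices covered by the matching `M`. -/
def coveredSymmDiff {V : Type*} {G : SimpleGraph V} (S : Set V) (M : G.Subgraph) : Set V :=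
  M.verts ∆ S

/-- Disjoint occurrence `𝒜 □ ℬ` of two (increasing) events. -/
def disjointOccurrence {V : Type*} (𝒜 ℬ : Set (Set V)) : Set (Set V) :=
  {C | ∃ A ∈ 𝒜, ∃ B ∈ ℬ, A ∩ B = ∅ ∧ C = A ∪ B}

/-- A random subset of `V` with law `μ` satisfies the BK inequality for increasing events.
Here `μ.toOuterMeasure 𝒜` is the probability of the event `𝒜`. -/
def SatisfiesBKIncreasing {V : Type*} (μ : PMF (Set V)) : Prop :=
  ∀ 𝒜 ℬ : Set (Set V), IsUpperSet 𝒜 → IsUpperSet ℬ →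
    μ.toOuterMeasure (disjointOccurrence 𝒜 ℬ) ≤ μ.toOuterMeasure 𝒜 * μ.toOuterMeasure ℬ

end BKMatching

/-!
For a pair `(M, N)` of maximum matchings, interchange `M` and `N` independently on each connected
component of `M ∪ N`. This turns the pair into a point `ω` of a discrete cube, and complementing
`ω` interchanges the two matchings. A component with `k` edges has at most `k + 1` vertices, and
it carries equally many edges of `M` and of `N` by maximality, so each of the two matchings misses
at most one of its vertices; when both miss one, these vertices lie on the same side of the
bipartition. Hence a component contains at most one vertex of `B(M) \ B(N)`, and disjoint subsets
of `B(M)` that witness `𝒜` and `ℬ` depend on disjoint sets of coordinates of `ω`. Reimer's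
inequality `|P □ Q| ≤ |P ∩ Qᶜ|`, where `Qᶜ` consists of the complements of the points of `Q`, then
bounds the number of `ω` for which `B(M)` is in `𝒜 □ ℬ` by the number of `ω` with `B(M) ∈ 𝒜` and
`B(N) ∈ ℬ`. The interchanges are involutions of the set of pairs, so averaging over all pairs gives
the result.
-/

namespace BKMatching

open SimpleGraph
open scoped symmDiff

section Reimer

open Finset Matrix

variable {ι : Type*} [Fintype ι]

theorem sum_prod_mul_prod {κ R : Type*} [DecidableEq ι] [Fintype κ] [CommSemiring R]
    (f g : ι → κ → R) :
    ∑ y : ι → κ, (∏ i, f i (y i)) * ∏ i, g i (y i) = ∏ i, ∑ j, f i j * g i j := by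
  simp only [Fintype.prod_sum, prod_mul_distrib]

/-- The four vectors of `ℤ²` behind Reimer's theorem: `(1, 0)` and `(0, 1)` for `x = false`,
`(1, 1)` and `(1, -1)` for `x = true`. The first vector of each pair has `s = true`, the second one
`s = false`; the last argument is the coordinate, `false` being the first one. -/
def reimerVec : Bool → Bool → Bool → ℤ
  | false, s, j => if j = s then 0 else 1
  | true, s, j => if j && !s then -1 else 1

/-- The inner product of two of Reimer's vectors. -/
def reimerInner (x s y t : Bool) : ℤ := ∑ j, reimerVec x s j * reimerVec y t j

-- The pairs `(1, 0), (1, 1)` and `(1, -1), (0, 1)` are dual bases.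
theorem sum_reimerInner_mul_reimerInner (x s x' s' : Bool) :
    ∑ z, reimerInner (!z) false x s * reimerInner z true x' s' = reimerInner x s x' s' := by
  revert x s x' s'; decide

theorem eq_of_prod_reimerInner_not_ne_zero {z x s : ι → Bool}
    (h : ∏ i, reimerInner (!z i) false (x i) (s i) ≠ 0) {i : ι} (hi : s i = true) :
    z i = x i := by
  have key : ∀ a b, reimerInner (!a) false b true ≠ 0 → a = b := by decide
  exact key _ _ (hi ▸ prod_ne_zero_iff.mp h i (mem_univ i))

theorem eq_not_of_prod_reimerInner_ne_zero {z x s : ι → Bool}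
    (h : ∏ i, reimerInner (z i) true (x i) (s i) ≠ 0) {i : ι} (hi : s i = false) :
    z i = !x i := by
  have key : ∀ a b, reimerInner a true b false ≠ 0 → a = !b := by decide
  exact key _ _ (hi ▸ prod_ne_zero_iff.mp h i (mem_univ i))

/-- The matrix whose row `x` is the tensor product of the vectors `reimerVec (x i) (s x i)`. -/
def reimerMatrix (s : (ι → Bool) → ι → Bool) : Matrix (ι → Bool) (ι → Bool) ℤ :=
  of fun x y => ∏ i, reimerVec (x i) (s x i) (y i)

theorem reimerMatrix_mul_transpose_apply [DecidableEq ι] (s : (ι → Bool) → ι → Bool)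
    (x x' : ι → Bool) :
    (reimerMatrix s * (reimerMatrix s)ᵀ) x x' =
      ∑ z : ι → Bool, (∏ i, reimerInner (!z i) false (x i) (s x i)) *
        ∏ i, reimerInner (z i) true (x' i) (s x' i) :=
  calc (reimerMatrix s * (reimerMatrix s)ᵀ) x x'
      = ∏ i, reimerInner (x i) (s x i) (x' i) (s x' i) := sum_prod_mul_prod _ _
    _ = ∏ i, ∑ z, reimerInner (!z) false (x i) (s x i) * reimerInner z true (x' i) (s x' i) := by
      simp only [sum_reimerInner_mul_reimerInner]
    _ = _ := (sum_prod_mul_prod _ _).symm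

/-- The vectors `(1, 1)` for `b = false` and `(1, 0)` for `b = true`. Modulo two, their tensor
products are functionals on which the rows of `reimerMatrix` are triangular. -/
def testVec (b j : Bool) : ZMod 2 := if b && j then 0 else 1

theorem sum_reimerVec_mul_testVec_self (x s : Bool) :
    ∑ j, (reimerVec x s j : ZMod 2) * testVec x j = 1 := by
  revert x s; decide

theorem sum_reimerVec_true_mul_testVec_false (s : Bool) :
    ∑ j, (reimerVec true s j : ZMod 2) * testVec false j = 0 := by
  revert s; decide

theorem eq_zero_of_vecMul_reimerMatrix_eq_zero [DecidableEq ι] {s : (ι → Bool) → ι → Bool}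
    {c : (ι → Bool) → ZMod 2}
    (hc : vecMul c ((Int.castRingHom (ZMod 2)).mapMatrix (reimerMatrix s)) = 0) :
    c = 0 := by
  have pairing (b : ι → Bool) :
      ∑ x, c x * ∏ i, ∑ j, (reimerVec (x i) (s x i) j : ZMod 2) * testVec (b i) j = 0 := by
    have hb := congrArg (· ⬝ᵥ fun y : ι → Bool => ∏ i, testVec (b i) (y i)) hc
    simp only [zero_dotProduct, ← dotProduct_mulVec] at hb
    rw [← hb]
    refine sum_congr rfl fun x _ => congrArg (c x * ·) ?_
    simp only [mulVec, dotProduct, RingHom.mapMatrix_apply, map_apply, reimerMatrix, of_apply,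
      map_prod, eq_intCast]
    exact (sum_prod_mul_prod _ _).symm
  funext b
  induction b using WellFoundedLT.induction with
  | ind b ih =>
    have hb := pairing b
    rw [Fintype.sum_eq_single b fun x hx => ?_] at hb
    · simp only [sum_reimerVec_mul_testVec_self, prod_const_one, mul_one] at hb
      exact hb
    by_cases hle : x ≤ b
    · exact mul_eq_zero_of_left (ih x (hle.lt_of_ne hx)) _
    · obtain ⟨i, hi⟩ := not_forall.mp hle
      obtain ⟨hbi, hxi⟩ := Bool.lt_iff.mp (not_le.mp hi)
      refine mul_eq_zero_of_right _ (prod_eq_zero (mem_univ i) ?_)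
      rw [hbi, hxi, sum_reimerVec_true_mul_testVec_false]

theorem det_reimerMatrix_ne_zero [DecidableEq ι] (s : (ι → Bool) → ι → Bool) :
    (reimerMatrix s).det ≠ 0 := by
  intro hdet
  have hdet₂ := (Int.castRingHom (ZMod 2)).map_det (reimerMatrix s)
  rw [hdet, map_zero] at hdet₂
  obtain ⟨c, hc₀, hc⟩ := exists_vecMul_eq_zero_iff.mpr hdet₂.symm
  exact hc₀ (eq_zero_of_vecMul_reimerMatrix_eq_zero hc)

theorem linearIndependent_row_reimerMatrix [DecidableEq ι] (s : (ι → Bool) → ι → Bool) :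
    LinearIndependent ℚ ((Int.castRingHom ℚ).mapMatrix (reimerMatrix s)).row := by
  refine linearIndependent_rows_of_det_ne_zero
    (A := (Int.castRingHom ℚ).mapMatrix (reimerMatrix s)) ?_
  rw [← RingHom.map_det, eq_intCast]
  exact Int.cast_ne_zero.mpr (det_reimerMatrix_ne_zero s)

-- The wings of the butterfly with body `x` are the cube of the points that agree with `x` where
-- `s x` holds and the cube of the points that agree with `xᶜ` elsewhere. The Gram matrix of the
-- rows indexed by `X` has full rank and factors through the points that lie on a wing of either
-- kind.
theorem card_le_card_of_butterflies {ι : Type*} [Finite ι] (X Z : Finset (ι → Bool))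
    (s : (ι → Bool) → ι → Bool)
    (hZ : ∀ z, ∀ x ∈ X, ∀ x' ∈ X, (∀ i, s x i = true → z i = x i) →
      (∀ i, s x' i = false → z i = !x' i) → z ∈ Z) :
    #X ≤ #Z := by
  classical
  have := Fintype.ofFinite ι
  let T : Matrix X (ι → Bool) ℤ := (reimerMatrix s).submatrix (↑) id
  let C : Matrix X Z ℤ := of fun x z => ∏ i, reimerInner (!z.1 i) false (x.1 i) (s x i)
  let D : Matrix Z X ℤ := of fun z x => ∏ i, reimerInner (z.1 i) true (x.1 i) (s x i)
  have hgram : T * Tᵀ = C * D := by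
    ext x x'
    refine (reimerMatrix_mul_transpose_apply s x x').trans
      ((sum_subset (subset_univ Z) fun z _ hz => ?_).symm.trans (sum_coe_sort Z _).symm)
    by_contra hne
    obtain ⟨hx, hx'⟩ := mul_ne_zero_iff.mp hne
    exact hz (hZ z x x.2 x' x'.2 (fun i => eq_of_prod_reimerInner_not_ne_zero hx)
      fun i => eq_not_of_prod_reimerInner_ne_zero hx')
  let φ := Int.castRingHom ℚ
  have hT : LinearIndependent ℚ (T.map φ).row :=
    (linearIndependent_row_reimerMatrix s).comp _ Subtype.val_injective
  calc #X = (T.map φ).rank := by rw [hT.rank_matrix, Fintype.card_coe]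
    _ = (T.map φ * (T.map φ)ᵀ).rank := (rank_self_mul_transpose _).symm
    _ = (C.map φ * D.map φ).rank := by
      rw [← transpose_map, ← Matrix.map_mul, hgram, Matrix.map_mul]
    _ ≤ (C.map φ).rank := rank_mul_le_left _ _
    _ ≤ #Z := (rank_le_card_width _).trans_eq (Fintype.card_coe Z)

/-- The disjoint occurrence of two arbitrary events in the discrete cube: the points for which
disjoint sets of coordinates witness `P` and `Q`. -/
def cubeBox {ι : Type*} (P Q : Set (ι → Bool)) : Set (ι → Bool) :=
  {x | ∃ I J : Set ι, Disjoint I J ∧ (∀ y, Set.EqOn y x I → y ∈ P) ∧ ∀ y, Set.EqOn y x J → y ∈ Q}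

theorem ncard_cubeBox_le {ι : Type*} [Finite ι] (P Q : Set (ι → Bool)) :
    (cubeBox P Q).ncard ≤ (P ∩ compl ⁻¹' Q).ncard := by
  classical
  have h : ∀ x ∈ cubeBox P Q, ∃ I J : Set ι, Disjoint I J ∧
    (∀ y, Set.EqOn y x I → y ∈ P) ∧ ∀ y, Set.EqOn y x J → y ∈ Q := fun _ hx => hx
  choose! I J hIJ hP hQ using h
  have := Fintype.ofFinite ι
  rw [Set.ncard_eq_toFinset_card', Set.ncard_eq_toFinset_card']
  refine card_le_card_of_butterflies _ _ (fun x i => decide (i ∈ I x))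
    fun z x hx x' hx' hzx hzx' => ?_
  simp only [Set.mem_toFinset, decide_eq_true_eq, decide_eq_false_iff_not] at hx hx' hzx hzx' ⊢
  refine ⟨hP x hx z hzx, hQ x' hx' _ fun i hi => ?_⟩
  rw [Pi.compl_apply, hzx' i ((hIJ x' hx').notMem_of_mem_right hi)]
  exact Bool.not_not _

end Reimer

section Fibres

variable {V κ : Type*} {r : V → κ} {X Y : Set V}

theorem mem_ite_setOf {ω : κ → Bool} {v : V} :
    v ∈ {v | ω (r v)}.ite X Y ↔ if ω (r v) then v ∈ X else v ∈ Y := by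
  by_cases h : ω (r v) = true <;> simp [Set.ite, h]

theorem ite_setOf_compl (ω : κ → Bool) :
    {v | ωᶜ (r v)}.ite X Y = {v | ω (r v)}.ite Y X := by
  ext v
  by_cases h : ω (r v) = true <;> simp [Set.ite, h]

theorem subset_ite_setOf_of_eqOn {ω ω' : κ → Bool} {E : Set V}
    (hE : E ⊆ {v | ω (r v)}.ite X Y) (h : Set.EqOn ω' ω (r '' (E ∩ X ∆ Y))) :
    E ⊆ {v | ω' (r v)}.ite X Y := by
  intro v hv
  have hvω := hE hv
  by_cases hD : v ∈ X ∆ Y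
  · rwa [mem_ite_setOf, h ⟨v, ⟨hv, hD⟩, rfl⟩, ← mem_ite_setOf]
  · have hXY : v ∈ X ↔ v ∈ Y := by
      rw [Set.mem_symmDiff] at hD
      tauto
    rw [mem_ite_setOf, hXY, ite_self] at hvω ⊢
    exact hvω

theorem injOn_ite_setOf_inter_symmDiff (hXY : Set.InjOn r (X \ Y)) (hYX : Set.InjOn r (Y \ X))
    (ω : κ → Bool) : Set.InjOn r ({v | ω (r v)}.ite X Y ∩ X ∆ Y) := by
  rintro u ⟨hu, huD⟩ v ⟨hv, hvD⟩ huv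
  rw [mem_ite_setOf] at hu hv
  rw [huv] at hu
  rw [Set.mem_symmDiff] at huD hvD
  split_ifs at hu hv
  · exact hXY (by tauto) (by tauto) huv
  · exact hYX (by tauto) (by tauto) huv

theorem ncard_setOf_ite_mem_disjointOccurrence_le [Finite κ] (hXY : Set.InjOn r (X \ Y))
    (hYX : Set.InjOn r (Y \ X)) {𝒜 ℬ : Set (Set V)} (h𝒜 : IsUpperSet 𝒜) (hℬ : IsUpperSet ℬ) :
    {ω : κ → Bool | {v | ω (r v)}.ite X Y ∈ disjointOccurrence 𝒜 ℬ}.ncard ≤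
      {ω : κ → Bool | {v | ω (r v)}.ite X Y ∈ 𝒜 ∧ {v | ω (r v)}.ite Y X ∈ ℬ}.ncard := by
  let Z (ω : κ → Bool) : Set V := {v | ω (r v)}.ite X Y
  have hbox : Z ⁻¹' disjointOccurrence 𝒜 ℬ ⊆ cubeBox (Z ⁻¹' 𝒜) (Z ⁻¹' ℬ) := by
    rintro ω ⟨A, hA, B, hB, hAB, hω : Z ω = A ∪ B⟩
    have hAZ : A ⊆ Z ω := hω ▸ Set.subset_union_left
    have hBZ : B ⊆ Z ω := hω ▸ Set.subset_union_right
    refine ⟨r '' (A ∩ X ∆ Y), r '' (B ∩ X ∆ Y), Set.disjoint_left.mpr ?_,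
      fun _ h => h𝒜 (subset_ite_setOf_of_eqOn hAZ h) hA,
      fun _ h => hℬ (subset_ite_setOf_of_eqOn hBZ h) hB⟩
    rintro _ ⟨u, ⟨huA, huD⟩, rfl⟩ ⟨v, ⟨hvB, hvD⟩, hvu⟩
    have huv : v = u :=
      injOn_ite_setOf_inter_symmDiff hXY hYX ω ⟨hBZ hvB, hvD⟩ ⟨hAZ huA, huD⟩ hvu
    exact Set.eq_empty_iff_forall_notMem.mp hAB u ⟨huA, huv ▸ hvB⟩
  calc (Z ⁻¹' disjointOccurrence 𝒜 ℬ).ncard ≤ (cubeBox (Z ⁻¹' 𝒜) (Z ⁻¹' ℬ)).ncard :=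
        Set.ncard_le_ncard hbox
    _ ≤ (Z ⁻¹' 𝒜 ∩ compl ⁻¹' (Z ⁻¹' ℬ)).ncard := ncard_cubeBox_le _ _
    _ = {ω | Z ω ∈ 𝒜 ∧ {v | ω (r v)}.ite Y X ∈ ℬ}.ncard :=
        congrArg Set.ncard <| Set.ext fun ω => and_congr_right fun _ =>
          iff_of_eq (congrArg (· ∈ ℬ) (ite_setOf_compl ω))

end Fibres

section Averaging

variable {α Ω : Type*} {φ : Ω → α → α}

theorem sum_ncard_setOf_apply_mem [Fintype α] [Fintype Ω]
    (hφ : ∀ ω, Function.Bijective (φ ω)) (E : Set α) :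
    ∑ a, {ω | φ ω a ∈ E}.ncard = Fintype.card Ω * E.ncard := by
  classical
  calc ∑ a, {ω | φ ω a ∈ E}.ncard
      = ∑ ω, (φ ω ⁻¹' E).ncard := by
        simp only [Set.ncard_eq_toFinset_card', Set.toFinset_ofPred, Set.preimage]
        exact Finset.sum_card_bipartiteAbove_eq_sum_card_bipartiteBelow fun a ω => φ ω a ∈ E
    _ = ∑ _ω : Ω, E.ncard := Finset.sum_congr rfl fun ω _ =>
        Set.ncard_preimage_of_injective_subset_range (hφ ω).1
          ((hφ ω).2.range_eq ▸ Set.subset_univ E)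
    _ = Fintype.card Ω * E.ncard := by
        rw [Finset.sum_const, Finset.card_univ, smul_eq_mul]

theorem ncard_le_ncard_of_forall_ncard_setOf_apply_mem_le [Finite α] [Finite Ω] [Nonempty Ω]
    (hφ : ∀ ω, Function.Bijective (φ ω)) {E F : Set α}
    (h : ∀ a, {ω | φ ω a ∈ E}.ncard ≤ {ω | φ ω a ∈ F}.ncard) : E.ncard ≤ F.ncard := by
  have := Fintype.ofFinite α
  have := Fintype.ofFinite Ω
  refine Nat.le_of_mul_le_mul_left ?_ (Fintype.card_pos (α := Ω))
  rw [← sum_ncard_setOf_apply_mem hφ, ← sum_ncard_setOf_apply_mem hφ]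
  exact Finset.sum_le_sum fun a _ => h a

end Averaging

section Exchange

variable {V : Type*} {G : SimpleGraph V} {M N : G.Subgraph} {U : Set V}

/-- A set of vertices is saturated for `M` when no edge of `M` leaves it, that is, when it is a
union of connected components of `M.spanningCoe`. -/
def IsSaturated (M : G.Subgraph) (U : Set V) : Prop :=
  ∀ ⦃v w⦄, M.Adj v w → (v ∈ U ↔ w ∈ U)

theorem IsSaturated.anti (hU : IsSaturated N U) (h : M ≤ N) : IsSaturated M U :=
  fun _ _ hvw => hU (h.2 hvw)

theorem IsSaturated.compl (hU : IsSaturated M U) : IsSaturated M Uᶜ :=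
  fun _ _ hvw => not_congr (hU hvw)

/-- The part of the subgraph `M` inside `U`. Unlike in `M.induce U`, vertices of `U` outside `M`
are not added. -/
def restrict (M : G.Subgraph) (U : Set V) : G.Subgraph :=
  M.induce (M.verts ∩ U)

theorem restrict_verts (M : G.Subgraph) (U : Set V) : (restrict M U).verts = M.verts ∩ U :=
  rfl

theorem restrict_adj {v w : V} : (restrict M U).Adj v w ↔ v ∈ U ∧ w ∈ U ∧ M.Adj v w := by
  simp only [restrict, Subgraph.induce_adj, Set.mem_inter_iff]
  exact ⟨fun h => ⟨h.1.2, h.2.1.2, h.2.2⟩,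
    fun h => ⟨⟨M.edge_vert h.2.2, h.1⟩, ⟨M.edge_vert h.2.2.symm, h.2.1⟩, h.2.2⟩⟩

theorem restrict_sup_restrict_compl (hU : IsSaturated M U) :
    restrict M U ⊔ restrict M Uᶜ = M := by
  ext v w
  · exact Set.ext_iff.mp (Set.inter_union_compl M.verts U) v
  · have := @hU v w
    simp only [Subgraph.sup_adj, restrict_adj, Set.mem_compl_iff]
    tauto

theorem isMatching_restrict (hM : M.IsMatching) (hU : IsSaturated M U) :
    (restrict M U).IsMatching := by
  rintro v ⟨hv, hvU⟩
  obtain ⟨w, hvw, hw⟩ := hM hv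
  exact ⟨w, restrict_adj.mpr ⟨hvU, (hU hvw).mp hvU, hvw⟩, fun x hx => hw x (restrict_adj.mp hx).2.2⟩

/-- The subgraph that coincides with `M` inside `U` and with `N` outside `U`. -/
def exchange (M N : G.Subgraph) (U : Set V) : G.Subgraph :=
  restrict M U ⊔ restrict N Uᶜ

theorem exchange_verts (M N : G.Subgraph) (U : Set V) :
    (exchange M N U).verts = U.ite M.verts N.verts :=
  rfl

theorem exchange_compl (M N : G.Subgraph) (U : Set V) :
    exchange M N Uᶜ = exchange N M U := by
  rw [exchange, exchange, compl_compl, sup_comm]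

theorem restrict_exchange (M N : G.Subgraph) (U : Set V) :
    restrict (exchange M N U) U = restrict M U := by
  ext v w
  · exact Set.ext_iff.mp (Set.ite_inter_self U M.verts N.verts) v
  · simp only [exchange, Subgraph.sup_adj, restrict_adj, Set.mem_compl_iff]
    tauto

theorem exchange_exchange (hU : IsSaturated M U) :
    exchange (exchange M N U) (exchange N M U) U = M := by
  rw [exchange, restrict_exchange, ← exchange_compl, restrict_exchange,
    restrict_sup_restrict_compl hU]

theorem exchange_sup_exchange (hM : IsSaturated M U) (hN : IsSaturated N U) :
    exchange M N U ⊔ exchange N M U = M ⊔ N := by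
  rw [exchange, exchange, sup_comm (restrict N U), sup_sup_sup_comm,
    restrict_sup_restrict_compl hM, sup_comm (restrict N Uᶜ), restrict_sup_restrict_compl hN]

theorem coveredSymmDiff_exchange (S : Set V) (M N : G.Subgraph) (U : Set V) :
    coveredSymmDiff S (exchange M N U) = U.ite (coveredSymmDiff S M) (coveredSymmDiff S N) := by
  ext v
  by_cases hv : v ∈ U <;>
    simp [coveredSymmDiff, exchange_verts, Set.ite, Set.mem_symmDiff, hv]

theorem isMatching_exchange (hM : M.IsMatching) (hN : N.IsMatching) (hMU : IsSaturated M U)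
    (hNU : IsSaturated N U) : (exchange M N U).IsMatching := by
  have hM' := isMatching_restrict hM hMU
  have hN' := isMatching_restrict hN hNU.compl
  refine hM'.sup hN' ?_
  rw [hM'.support_eq_verts, hN'.support_eq_verts]
  exact disjoint_compl_right.mono Set.inter_subset_right Set.inter_subset_right

end Exchange

section Counting

variable {V : Type*} [Finite V] {G : SimpleGraph V} {M N : G.Subgraph} {S T U : Set V}

theorem sum_degree_spanningCoe [M.spanningCoe.LocallyFinite] (hM : M.IsMatching) (s : Finset V) :
    ∑ v ∈ s, M.spanningCoe.degree v = (M.verts ∩ s).ncard := by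
  classical
  have hdegree (v : V) : M.spanningCoe.degree v = if v ∈ M.verts then 1 else 0 := by
    have (w : V) : Fintype (M.neighborSet w) := Fintype.ofFinite _
    rw [Subgraph.degree_spanningCoe]
    split_ifs with hv
    · exact Subgraph.isMatching_iff_forall_degree.mp hM v hv
    · exact Subgraph.degree_of_notMem_verts hv
  have hfilter : M.verts ∩ s = s.filter (· ∈ M.verts) := by
    rw [Finset.coe_filter, Set.inter_comm]; rfl
  simp only [hdegree, ← Finset.card_filter, hfilter, Set.ncard_coe_finset]

theorem two_mul_ncard_edgeSet (hM : M.IsMatching) : 2 * M.edgeSet.ncard = M.verts.ncard := by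
  classical
  have := Fintype.ofFinite V
  rw [← Subgraph.edgeSet_spanningCoe, Set.ncard_eq_toFinset_card', ← edgeFinset,
    ← sum_degrees_eq_twice_card_edges, sum_degree_spanningCoe hM, Finset.coe_univ, Set.inter_univ]

theorem ncard_verts_inter_eq_ncard_edgeSet (hG : G.IsBipartiteWith S T) (hM : M.IsMatching) :
    (M.verts ∩ S).ncard = M.edgeSet.ncard := by
  classical
  have := Fintype.ofFinite V
  have hST : M.spanningCoe.IsBipartiteWith S.toFinset T.toFinset := by
    rw [Set.coe_toFinset, Set.coe_toFinset]
    exact ⟨hG.disjoint, fun _ _ hvw => hG.mem_of_adj (M.adj_sub hvw)⟩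
  have hsum := sum_degree_spanningCoe hM S.toFinset
  rw [Set.coe_toFinset] at hsum
  rw [← Subgraph.edgeSet_spanningCoe, Set.ncard_eq_toFinset_card' M.spanningCoe.edgeSet,
    ← edgeFinset, ← isBipartiteWith_sum_degrees_eq_card_edges hST, hsum]

theorem ncard_ite (t s s' : Set V) : (t.ite s s').ncard = (s ∩ t).ncard + (s' \ t).ncard := by
  rw [← Set.ncard_inter_add_ncard_sdiff_eq_ncard _ t, Set.ite_inter_self, Set.ite_sdiff_self]

theorem mem_maximumMatchings_iff :
    M ∈ maximumMatchings G ↔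
      M.IsMatching ∧ ∀ N : G.Subgraph, N.IsMatching → N.verts.ncard ≤ M.verts.ncard := by
  refine and_congr_right fun hM => forall₂_congr fun N hN => ?_
  rw [← two_mul_ncard_edgeSet hM, ← two_mul_ncard_edgeSet hN]
  exact (Nat.mul_le_mul_left_iff two_pos).symm

theorem ncard_verts_inter_le (hM : M ∈ maximumMatchings G) (hN : N.IsMatching)
    (hMU : IsSaturated M U) (hNU : IsSaturated N U) :
    (N.verts ∩ U).ncard ≤ (M.verts ∩ U).ncard := by
  rw [mem_maximumMatchings_iff] at hM
  have hmax := hM.2 _ (isMatching_exchange hN hM.1 hNU hMU)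
  rw [exchange_verts, ncard_ite, ← Set.ncard_inter_add_ncard_sdiff_eq_ncard M.verts U] at hmax
  exact Nat.le_of_add_le_add_right hmax

theorem ncard_verts_inter_eq (hM : M ∈ maximumMatchings G) (hN : N ∈ maximumMatchings G)
    (hMU : IsSaturated M U) (hNU : IsSaturated N U) :
    (M.verts ∩ U).ncard = (N.verts ∩ U).ncard :=
  (ncard_verts_inter_le hN hM.1 hNU hMU).antisymm (ncard_verts_inter_le hM hN.1 hMU hNU)

theorem ncard_verts_inter_inter_eq (hG : G.IsBipartiteWith S T) (hM : M ∈ maximumMatchings G)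
    (hN : N ∈ maximumMatchings G) (hMU : IsSaturated M U) (hNU : IsSaturated N U) :
    (M.verts ∩ U ∩ S).ncard = (N.verts ∩ U ∩ S).ncard := by
  have hM' := isMatching_restrict hM.1 hMU
  have hN' := isMatching_restrict hN.1 hNU
  rw [← restrict_verts M U, ← restrict_verts N U, ncard_verts_inter_eq_ncard_edgeSet hG hM',
    ncard_verts_inter_eq_ncard_edgeSet hG hN']
  refine Nat.eq_of_mul_eq_mul_left two_pos ?_
  rw [two_mul_ncard_edgeSet hM', two_mul_ncard_edgeSet hN']
  exact ncard_verts_inter_eq hM hN hMU hNU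

theorem exchange_mem_maximumMatchings (hM : M ∈ maximumMatchings G)
    (hN : N ∈ maximumMatchings G) (hMU : IsSaturated M U) (hNU : IsSaturated N U) :
    exchange M N U ∈ maximumMatchings G := by
  refine mem_maximumMatchings_iff.mpr ⟨isMatching_exchange hM.1 hN.1 hMU hNU, fun L hL => ?_⟩
  rw [exchange_verts, ncard_ite, ncard_verts_inter_eq hM hN hMU hNU,
    Set.ncard_inter_add_ncard_sdiff_eq_ncard]
  exact (mem_maximumMatchings_iff.mp hN).2 L hL

end Counting

section Components

variable {V : Type*} {G : SimpleGraph V} {L M N : G.Subgraph} {S T : Set V}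

theorem isSaturated_supp (C : M.spanningCoe.ConnectedComponent) : IsSaturated M C.supp :=
  fun _ _ hvw => C.mem_supp_congr_adj hvw

theorem ncard_supp_le_ncard_edgeSet_add_one {H : SimpleGraph V} (C : H.ConnectedComponent) :
    C.supp.ncard ≤ C.toSimpleGraph.spanningCoe.edgeSet.ncard + 1 := by
  rw [SimpleGraph.edgeSet_map, Set.ncard_image_of_injective _ (Function.Embedding.injective _)]
  exact C.connected_toSimpleGraph.card_vert_le_card_edgeSet_add_one

/-- The vertex chosen to represent the connected component of `v` in `H`. -/
noncomputable def componentRep (H : SimpleGraph V) (v : V) : V :=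
  (H.connectedComponentMk v).out

theorem componentRep_eq_iff {H : SimpleGraph V} {v w : V} :
    componentRep H v = componentRep H w ↔
      H.connectedComponentMk v = H.connectedComponentMk w :=
  (Function.LeftInverse.injective Quot.out_eq).eq_iff

variable [Finite V]

theorem ncard_supp_le (C : (M ⊔ N).spanningCoe.ConnectedComponent) :
    C.supp.ncard ≤ (restrict M C.supp).edgeSet.ncard + (restrict N C.supp).edgeSet.ncard + 1 := by
  have hsub : C.toSimpleGraph.spanningCoe.edgeSet ⊆
      (restrict M C.supp).edgeSet ∪ (restrict N C.supp).edgeSet := by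
    rintro ⟨v, w⟩ hvw
    obtain ⟨hv, hadj⟩ := C.adj_spanningCoe_toSimpleGraph.mp hvw
    have hw := (C.mem_supp_congr_adj hadj).mp hv
    exact hadj.imp (fun h => restrict_adj.mpr ⟨hv, hw, h⟩) fun h => restrict_adj.mpr ⟨hv, hw, h⟩
  calc C.supp.ncard ≤ C.toSimpleGraph.spanningCoe.edgeSet.ncard + 1 :=
        ncard_supp_le_ncard_edgeSet_add_one C
    _ ≤ ((restrict M C.supp).edgeSet ∪ (restrict N C.supp).edgeSet).ncard + 1 :=
        Nat.add_le_add_right (Set.ncard_le_ncard hsub) 1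
    _ ≤ _ := Nat.add_le_add_right (Set.ncard_union_le _ _) 1

theorem subsingleton_supp_sdiff_verts (hM : M ∈ maximumMatchings G) (hN : N ∈ maximumMatchings G)
    (hL : L ∈ maximumMatchings G) (hLMN : L ≤ M ⊔ N)
    (C : (M ⊔ N).spanningCoe.ConnectedComponent) : (C.supp \ L.verts).Subsingleton := by
  have two_mul_ncard {K : G.Subgraph} (hK : K ∈ maximumMatchings G) (hKMN : K ≤ M ⊔ N) :
      2 * (restrict K C.supp).edgeSet.ncard = (L.verts ∩ C.supp).ncard := by
    have hKC := (isSaturated_supp C).anti hKMN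
    rw [two_mul_ncard_edgeSet (isMatching_restrict hK.1 hKC), restrict_verts]
    exact ncard_verts_inter_eq hK hL hKC ((isSaturated_supp C).anti hLMN)
  have hcard := ncard_supp_le C
  rw [← Set.ncard_inter_add_ncard_sdiff_eq_ncard _ L.verts, Set.inter_comm] at hcard
  rw [← Set.ncard_le_one_iff_subsingleton]
  linarith [two_mul_ncard hM le_sup_left, two_mul_ncard hN le_sup_right]

theorem mem_of_notMem_verts (hG : G.IsBipartiteWith S T) (hM : M ∈ maximumMatchings G)
    (hN : N ∈ maximumMatchings G) {C : (M ⊔ N).spanningCoe.ConnectedComponent} {u v : V}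
    (hu : u ∈ C.supp \ M.verts) (hv : v ∈ C.supp \ N.verts) (huS : u ∈ S) : v ∈ S := by
  by_contra hvS
  have hsub : (C.supp \ N.verts).Subsingleton :=
    subsingleton_supp_sdiff_verts hM hN hN le_sup_right C
  have hNS : C.supp ∩ S ⊆ N.verts ∩ C.supp ∩ S := fun w hw =>
    ⟨⟨by_contra fun hwN => hvS (hsub ⟨hw.1, hwN⟩ hv ▸ hw.2), hw.1⟩, hw.2⟩
  have hMS : M.verts ∩ C.supp ∩ S ⊂ C.supp ∩ S :=
    ⟨fun w hw => ⟨hw.1.2, hw.2⟩, fun h => hu.2 (h ⟨hu.1, huS⟩).1.1⟩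
  exact ((Set.ncard_lt_ncard hMS).trans_le (Set.ncard_le_ncard hNS)).ne
    (ncard_verts_inter_inter_eq hG hM hN ((isSaturated_supp C).anti le_sup_left)
      ((isSaturated_supp C).anti le_sup_right))

theorem injOn_componentRep (hG : G.IsBipartiteWith S T) (hM : M ∈ maximumMatchings G)
    (hN : N ∈ maximumMatchings G) :
    Set.InjOn (componentRep (M ⊔ N).spanningCoe) (coveredSymmDiff S M \ coveredSymmDiff S N) := by
  intro u hu v hv huv
  rw [componentRep_eq_iff] at huv
  let C := (M ⊔ N).spanningCoe.connectedComponentMk v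
  have huC : u ∈ C.supp := huv
  have hvC : v ∈ C.supp := rfl
  have hsubM := subsingleton_supp_sdiff_verts hM hN hM le_sup_left C
  have hsubN := subsingleton_supp_sdiff_verts hM hN hN le_sup_right C
  simp only [coveredSymmDiff, Set.mem_sdiff, Set.mem_symmDiff] at hu hv
  by_cases huS : u ∈ S <;> by_cases hvS : v ∈ S
  · exact hsubM ⟨huC, by tauto⟩ ⟨hvC, by tauto⟩
  · exact absurd (mem_of_notMem_verts hG hM hN ⟨huC, by tauto⟩ ⟨hvC, by tauto⟩ huS) hvS
  · exact absurd (mem_of_notMem_verts hG hM hN ⟨hvC, by tauto⟩ ⟨huC, by tauto⟩ hvS) huS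
  · exact hsubN ⟨huC, by tauto⟩ ⟨hvC, by tauto⟩

end Components

section Swap

variable {V : Type*} {G : SimpleGraph V}

/-- The union of the connected components of `H` selected by `ω`, where `ω` is read at the
representatives of the components. -/
def selectedComponents (H : SimpleGraph V) (ω : V → Bool) : Set V :=
  {v | ω (componentRep H v)}

theorem isSaturated_selectedComponents (M : G.Subgraph) (ω : V → Bool) :
    IsSaturated M (selectedComponents M.spanningCoe ω) := by
  intro v w hvw
  have hrep : componentRep M.spanningCoe v = componentRep M.spanningCoe w :=
    componentRep_eq_iff.mpr (ConnectedComponent.connectedComponentMk_eq_of_adj hvw)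
  simp only [selectedComponents, Set.mem_ofPred_eq, hrep]

/-- The pair obtained from `(M, N)` by keeping `M` and `N` on the components of `M ⊔ N` selected by
`ω` and interchanging them on the other components. -/
noncomputable def swap (ω : V → Bool) (p : G.Subgraph × G.Subgraph) : G.Subgraph × G.Subgraph :=
  let U := selectedComponents (p.1 ⊔ p.2).spanningCoe ω
  (exchange p.1 p.2 U, exchange p.2 p.1 U)

theorem swap_involutive (ω : V → Bool) : Function.Involutive (swap (G := G) ω) := by
  intro ⟨M, N⟩
  have hU := isSaturated_selectedComponents (M ⊔ N) ω
  have hM := hU.anti le_sup_left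
  have hN := hU.anti le_sup_right
  simp only [swap, exchange_sup_exchange hM hN, exchange_exchange hM, exchange_exchange hN]

theorem swap_mem [Finite V] (ω : V → Bool) {p : G.Subgraph × G.Subgraph}
    (hp : p ∈ maximumMatchings G ×ˢ maximumMatchings G) :
    swap ω p ∈ maximumMatchings G ×ˢ maximumMatchings G :=
  have hU := isSaturated_selectedComponents (p.1 ⊔ p.2) ω
  have hM := hU.anti le_sup_left
  have hN := hU.anti le_sup_right
  ⟨exchange_mem_maximumMatchings hp.1 hp.2 hM hN, exchange_mem_maximumMatchings hp.2 hp.1 hN hM⟩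

theorem ncard_setOf_swap_le [Finite V] {S T : Set V} (hG : G.IsBipartiteWith S T)
    {p : G.Subgraph × G.Subgraph} (hp : p ∈ maximumMatchings G ×ˢ maximumMatchings G)
    {𝒜 ℬ : Set (Set V)} (h𝒜 : IsUpperSet 𝒜) (hℬ : IsUpperSet ℬ) :
    {ω | coveredSymmDiff S (swap ω p).1 ∈ disjointOccurrence 𝒜 ℬ}.ncard ≤
      {ω | coveredSymmDiff S (swap ω p).1 ∈ 𝒜 ∧ coveredSymmDiff S (swap ω p).2 ∈ ℬ}.ncard := by
  simp only [swap, coveredSymmDiff_exchange]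
  refine ncard_setOf_ite_mem_disjointOccurrence_le (injOn_componentRep hG hp.1 hp.2) ?_ h𝒜 hℬ
  rw [sup_comm]
  exact injOn_componentRep hG hp.2 hp.1

theorem ncard_disjointOccurrence_mul_ncard_le [Finite V] {S T : Set V}
    (hG : G.IsBipartiteWith S T) {𝒜 ℬ : Set (Set V)} (h𝒜 : IsUpperSet 𝒜) (hℬ : IsUpperSet ℬ) :
    (maximumMatchings G ∩ coveredSymmDiff S ⁻¹' disjointOccurrence 𝒜 ℬ).ncard *
        (maximumMatchings G).ncard ≤
      (maximumMatchings G ∩ coveredSymmDiff S ⁻¹' 𝒜).ncard *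
        (maximumMatchings G ∩ coveredSymmDiff S ⁻¹' ℬ).ncard := by
  rw [← Set.ncard_prod, ← Set.ncard_prod]
  refine ncard_le_ncard_of_forall_ncard_setOf_apply_mem_le
    (fun ω => (swap_involutive ω).bijective) fun p => ?_
  by_cases hp : p ∈ maximumMatchings G ×ˢ maximumMatchings G
  · have hmem ω := swap_mem ω hp
    have h := ncard_setOf_swap_le hG hp h𝒜 hℬ
    simp only [Set.mem_prod] at hmem
    simpa [hmem] using h
  · have hempty : {ω | swap ω p ∈ (maximumMatchings G ∩
        coveredSymmDiff S ⁻¹' disjointOccurrence 𝒜 ℬ) ×ˢ maximumMatchings G} = ∅ := by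
      refine Set.eq_empty_of_forall_notMem fun ω hω => hp ?_
      rw [← swap_involutive ω p]
      exact swap_mem ω ⟨hω.1.1, hω.2⟩
    rw [hempty, Set.ncard_empty]
    exact Nat.zero_le _

end Swap

theorem toOuterMeasure_map_uniformMaximumMatching {V : Type*} [Finite V] (G : SimpleGraph V)
    (S : Set V) (𝒞 : Set (Set V)) :
    ((uniformMaximumMatching G).map (coveredSymmDiff S)).toOuterMeasure 𝒞 =
      ((maximumMatchings G ∩ coveredSymmDiff S ⁻¹' 𝒞).ncard : ENNReal) /
        (maximumMatchings G).ncard := by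
  classical
  rw [PMF.toOuterMeasure_map_apply, uniformMaximumMatching,
    PMF.toOuterMeasure_uniformOfFinset_apply, ← Set.ncard_coe_finset, ← Set.ncard_coe_finset,
    Finset.coe_filter]
  simp only [Set.Finite.coe_toFinset, Set.Finite.mem_toFinset]
  rfl

end BKMatching

theorem theorem4 {V : Type*} [Finite V] (G : SimpleGraph V) (S T : Set V)
    (hG : G.IsBipartiteWith S T) (hV : S ∪ T = Set.univ) :
    BKMatching.SatisfiesBKIncreasing
      ((BKMatching.uniformMaximumMatching G).map (BKMatching.coveredSymmDiff S)) := by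
  intro 𝒜 ℬ h𝒜 hℬ
  have hcard := BKMatching.ncard_disjointOccurrence_mul_ncard_le hG h𝒜 hℬ
  have hpos : ((BKMatching.maximumMatchings G).ncard : ENNReal) ≠ 0 :=
    Nat.cast_ne_zero.mpr (BKMatching.maximumMatchings_nonempty G).ncard_pos.ne'
  have htop := ENNReal.natCast_ne_top (BKMatching.maximumMatchings G).ncard
  simp only [BKMatching.toOuterMeasure_map_uniformMaximumMatching]
  rw [← ENNReal.mul_div_mul_right _ _ hpos htop,
    ← ENNReal.mul_div_mul_comm (Or.inl hpos) (Or.inl htop)]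
  exact ENNReal.div_le_div_right (by exact_mod_cast hcard) _
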